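/- Let $X$ be a set and let $\operatorname{FIM}(X)$ be the free inverse monoid on $X$. Let $R$ be a set of pairs $(\ell,r)$ with $\ell,r\in\operatorname{FIM}(X)$, let $\simeq_{\mathcal P}$ be the congruence on $\operatorname{FIM}(X)$ generated by $R$, and let $M$ be an inverse monoid presented by $\mathcal P=\langle X:R\rangle$, that is, $M\cong \operatorname{FIM}(X)/{\simeq_{\mathcal P}}$. On an inverse monoid, the natural partial order is defined by $s\leqslant t$ if and only if $s=et$ for some idempotent $e$; a subset $A$ is closed if $a\in A$ and $a\leqslant s$ imply $s\in A$; and the closure of a subset is the smallest closed subset containing it. An inverse monoid is $E$-unitary if every element above an idempotent (in the natural partial order) is itself idempotent. An inverse subsemigroup $N$ of $\operatorname{FIM}(X)$ is normal if it contains all idempotents of $\operatorname{FIM}(X)$ and $s^{-1}ns\in N$ for all $s\in\operatorname{FIM}(X)$ and $n\in N$. Let $K(\mathcal P)$ be the kernel of $\simeq_{\mathcal P}$, i.e. the set of elements of $\operatorname{FIM}(X)$ that are $\simeq_{\mathcal P}$-related to an idempotent, and let $N(\mathcal P)$ be the smallest normal inverse subsemigroup of $\operatorname{FIM}(X)$ containing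 all the elements $\ell^{-1}r$ and $\ell r^{-1}$ with $(\ell,r)\in R$. Then $M$ is $E$-unitary if and only if $K(\mathcal P)$ is a closed inverse submonoid of $\operatorname{FIM}(X)$, and in that case $K(\mathcal P)$ is equal to the closure of $N(\mathcal P)$. -/

import Mathlib

namespace InvMon

/-- An inverse monoid: every element `a` has exactly one inverse `a⁻¹`, in the sense
`a a⁻¹ a = a` and `a⁻¹ a a⁻¹ = a⁻¹`. -/
class InverseMonoid (S : Type*) extends Monoid S, Inv S where
  mul_inv_mul : ∀ a : S, a * a⁻¹ * a = a
  inv_mul_inv : ∀ a : S, a⁻¹ * a * a⁻¹ = a⁻¹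
  inv_unique : ∀ a b : S, a * b * a = a → b * a * b = b → b = a⁻¹

section General

variable {S : Type*} [InverseMonoid S]

/-- The natural partial order: `s ≤ t` iff `s = e t` for some idempotent `e`. -/
def NatLE (s t : S) : Prop := ∃ e : S, IsIdempotentElem e ∧ s = e * t

/-- A subset closed in the natural order: it contains every element above one of its members. -/
def IsNatClosed (A : Set S) : Prop := ∀ a ∈ A, ∀ s : S, NatLE a s → s ∈ A

/-- The smallest closed subset containing `A`. -/
def natClosure (A : Set S) : Set S := ⋂₀ {C | IsNatClosed C ∧ A ⊆ C}

structure IsInverseSubsemigroup (N : Set S) : Prop where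
  mul_mem : ∀ a ∈ N, ∀ b ∈ N, a * b ∈ N
  inv_mem : ∀ a ∈ N, a⁻¹ ∈ N

structure IsInverseSubmonoid (N : Set S) : Prop extends IsInverseSubsemigroup N where
  one_mem : 1 ∈ N

/-- A normal inverse subsemigroup: full (it contains all idempotents) and closed under
conjugation. -/
structure IsNormalInverseSubsemigroup (N : Set S) : Prop extends IsInverseSubsemigroup N where
  full : ∀ e : S, IsIdempotentElem e → e ∈ N
  conj_mem : ∀ s : S, ∀ n ∈ N, s⁻¹ * n * s ∈ N

/-- The smallest normal inverse subsemigroup containing `Q`. -/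
def normalGenerated (Q : Set S) : Set S := ⋂₀ {N | IsNormalInverseSubsemigroup N ∧ Q ⊆ N}

/-- The kernel of a congruence: the elements congruent to an idempotent. -/
def conKernel (ρ : Con S) : Set S := {s | ∃ e : S, IsIdempotentElem e ∧ ρ s e}

variable (S) in
/-- `E`-unitary: every element above an idempotent is idempotent. -/
def IsEUnitary : Prop := ∀ e s : S, IsIdempotentElem e → NatLE e s → IsIdempotentElem s

end General

section Free

variable {X : Type*}

/-- The formal inverse of a word over `X ⊔ X⁻¹`; `Sum.inl x` is the letter `x` and `Sum.inr x` is
the letter `x⁻¹`. -/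
def wordInv (w : FreeMonoid (X ⊕ X)) : FreeMonoid (X ⊕ X) :=
  FreeMonoid.ofList (w.toList.map Sum.swap).reverse

theorem wordInv_mul (u v : FreeMonoid (X ⊕ X)) : wordInv (u * v) = wordInv v * wordInv u := by
  simp [wordInv]

theorem wordInv_wordInv (u : FreeMonoid (X ⊕ X)) : wordInv (wordInv u) = u := by
  simp [wordInv]

variable (X) in
/-- The defining pairs of the free inverse monoid (Vagner): `u u⁻¹ u = u` and
`u u⁻¹ v v⁻¹ = v v⁻¹ u u⁻¹` for all words `u`, `v`. -/
inductive VagnerRel : FreeMonoid (X ⊕ X) → FreeMonoid (X ⊕ X) → Prop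
  | regular (u) : VagnerRel (u * wordInv u * u) u
  | comm (u v) : VagnerRel (u * wordInv u * (v * wordInv v)) (v * wordInv v * (u * wordInv u))

variable (X) in
def vagnerCon : Con (FreeMonoid (X ⊕ X)) := conGen (VagnerRel X)

theorem vagnerCon_wordInv {u v : FreeMonoid (X ⊕ X)} (h : vagnerCon X u v) :
    vagnerCon X (wordInv u) (wordInv v) := by
  change ConGen.Rel (VagnerRel X) u v at h
  induction h with
  | of a b hab =>
    refine ConGen.Rel.of _ _ ?_
    cases hab with
    | regular u =>
      have := VagnerRel.regular (wordInv b)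
      simpa [wordInv_mul, wordInv_wordInv, mul_assoc] using this
    | comm u v =>
      have := VagnerRel.comm v u
      simpa [wordInv_mul, wordInv_wordInv, mul_assoc] using this
  | refl a => exact (vagnerCon X).refl _
  | symm h ih => exact (vagnerCon X).symm ih
  | trans h₁ h₂ ih₁ ih₂ => exact (vagnerCon X).trans ih₁ ih₂
  | mul h₁ h₂ ih₁ ih₂ =>
    rw [wordInv_mul, wordInv_mul]
    exact (vagnerCon X).mul ih₂ ih₁

variable (X) in
/-- The free inverse monoid on `X`: words over `X ⊔ X⁻¹` modulo the Vagner congruence. -/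
abbrev FIM : Type _ := (vagnerCon X).Quotient

namespace FIM

/-- Inversion on `FIM X`, induced by formal inversion of words. -/
def inv (a : FIM X) : FIM X :=
  Quotient.map' (s₁ := (vagnerCon X).toSetoid) (s₂ := (vagnerCon X).toSetoid)
    wordInv (fun _ _ h => vagnerCon_wordInv h) a

theorem inv_inv (a : FIM X) : inv (inv a) = a := by
  induction a using Con.induction_on with
  | H u => exact congrArg (Con.toQuotient (c := vagnerCon X)) (wordInv_wordInv u)

theorem mul_inv_mul (a : FIM X) : a * inv a * a = a := by
  induction a using Con.induction_on with
  | H u => exact (Con.eq _).2 (ConGen.Rel.of _ _ (VagnerRel.regular u))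

theorem inv_mul_inv (a : FIM X) : inv a * a * inv a = inv a := by
  simpa [inv_inv] using mul_inv_mul (inv a)

theorem comm (a b : FIM X) : a * inv a * (b * inv b) = b * inv b * (a * inv a) := by
  induction a, b using Con.induction_on₂ with
  | H u v => exact (Con.eq _).2 (ConGen.Rel.of _ _ (VagnerRel.comm u v))

theorem comm' (a b : FIM X) : inv a * a * (b * inv b) = b * inv b * (inv a * a) := by
  simpa [inv_inv] using comm (inv a) b

/-- Every idempotent `e` of `FIM X` satisfies `e = e e⁻¹`. -/
theorem idem_eq {e : FIM X} (he : e * e = e) : e = e * inv e := by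
  have h1 : inv e = inv e * e * (e * inv e) := by
    calc inv e = inv e * e * inv e := (inv_mul_inv e).symm
      _ = inv e * (e * e) * inv e := by rw [he]
      _ = _ := by simp only [mul_assoc]
  have h2 : inv e = e * (inv e * inv e) * e := by
    rw [comm'] at h1
    simpa only [mul_assoc] using h1
  have h3 : inv e * inv e = inv e := by
    have l : e * inv e = inv e := by
      calc e * inv e = e * (e * (inv e * inv e) * e) := by rw [← h2]
        _ = (e * e) * (inv e * inv e) * e := by simp only [mul_assoc]
        _ = inv e := by rw [he, ← h2]
    calc inv e * inv e = inv e * (e * inv e) := by rw [l]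
      _ = inv e := by rw [← mul_assoc, inv_mul_inv]
  rw [h3, mul_inv_mul] at h2
  rw [h2, he]

theorem idem_comm {e f : FIM X} (he : e * e = e) (hf : f * f = f) : e * f = f * e := by
  rw [idem_eq he, idem_eq hf, comm]

theorem inv_unique (a b : FIM X) (h₁ : a * b * a = a) (h₂ : b * a * b = b) : b = inv a := by
  have i₁ : b * a * (b * a) = b * a := by rw [← mul_assoc, h₂]
  have i₂ : a * b * (a * b) = a * b := by rw [← mul_assoc, h₁]
  have i₃ : inv a * a * (inv a * a) = inv a * a := by rw [← mul_assoc, inv_mul_inv]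
  have i₄ : a * inv a * (a * inv a) = a * inv a := by rw [← mul_assoc, mul_inv_mul]
  have e₁ : b * a = inv a * a := by
    calc b * a = b * a * (inv a * a) := by rw [mul_assoc, ← mul_assoc a, mul_inv_mul]
      _ = inv a * a * (b * a) := idem_comm i₁ i₃
      _ = inv a * a := by rw [mul_assoc, ← mul_assoc a, h₁]
  have e₂ : a * b = a * inv a := by
    calc a * b = a * inv a * (a * b) := by rw [← mul_assoc, mul_inv_mul]
      _ = a * b * (a * inv a) := idem_comm i₄ i₂
      _ = a * inv a := by rw [← mul_assoc, h₁]
  calc b = b * a * b := h₂.symm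
    _ = inv a * (a * b) := by rw [e₁, mul_assoc]
    _ = inv a := by rw [e₂, ← mul_assoc, inv_mul_inv]

end FIM

instance : InverseMonoid (FIM X) where
  inv := FIM.inv
  mul_inv_mul := FIM.mul_inv_mul
  inv_mul_inv := FIM.inv_mul_inv
  inv_unique := FIM.inv_unique

/-- The congruence on `FIM X` generated by the pairs in `R`. -/
def presCon (R : Set (FIM X × FIM X)) : Con (FIM X) := conGen fun l r => (l, r) ∈ R

/-- The kernel `K(P)` of the presentation `P = ⟨X : R⟩`. -/
def presKernel (R : Set (FIM X × FIM X)) : Set (FIM X) := conKernel (presCon R)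

/-- The set of all `l⁻¹ r` and `l r⁻¹` with `(l, r) ∈ R`. -/
def relators (R : Set (FIM X × FIM X)) : Set (FIM X) :=
  {q | ∃ l r : FIM X, (l, r) ∈ R ∧ (q = l⁻¹ * r ∨ q = l * r⁻¹)}

/-- The normal inverse subsemigroup `N(P)` generated by the relators of `P = ⟨X : R⟩`. -/
def presNormal (R : Set (FIM X × FIM X)) : Set (FIM X) := normalGenerated (relators R)

end Free

end InvMon

namespace InvMon

section General

variable {S : Type*} [InverseMonoid S]

/-! Let `π` be the quotient map onto `M`. Then `s` lies in the kernel K iff `π s` is idempotent, so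
K is always a normal inverse submonoid, and E-unitarity of `M` pulls back along `π` to closedness of
K (`isEUnitary_iff_isNatClosed_conKernel`). Relators map to idempotents, so N ⊆ K; if K is closed it
also contains the closure of N. Conversely, for any presentation, the closure C of N is closed and
normal, so a⁻¹b ∈ C defines a congruence (`closedNormalCon`). It identifies each defining pair,
hence contains the presentation congruence, and whatever it relates to an idempotent lies in C. -/

theorem idempotent_inv_eq {e : S} (he : IsIdempotentElem e) : e⁻¹ = e :=
  (InverseMonoid.inv_unique e e (by rw [he.eq, he.eq]) (by rw [he.eq, he.eq])).symm

theorem inverse_inv_inv (a : S) : a⁻¹⁻¹ = a :=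
  (InverseMonoid.inv_unique a⁻¹ a (InverseMonoid.inv_mul_inv a)
    (InverseMonoid.mul_inv_mul a)).symm

theorem isIdempotentElem_inv_mul (a : S) : IsIdempotentElem (a⁻¹ * a) := by
  rw [IsIdempotentElem, ← mul_assoc, InverseMonoid.inv_mul_inv]

theorem isIdempotentElem_mul_inv (a : S) : IsIdempotentElem (a * a⁻¹) := by
  rw [IsIdempotentElem, ← mul_assoc, InverseMonoid.mul_inv_mul]

theorem isIdempotentElem_mul {e f : S} (he : IsIdempotentElem e) (hf : IsIdempotentElem f) :
    IsIdempotentElem (e * f) := by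
  have he' : ∀ z : S, e * (e * z) = e * z := fun z => by rw [← mul_assoc, he.eq]
  have hf' : ∀ z : S, f * (f * z) = f * z := fun z => by rw [← mul_assoc, hf.eq]
  have h1 := InverseMonoid.mul_inv_mul (e * f)
  have h2 := InverseMonoid.inv_mul_inv (e * f)
  set x := (e * f)⁻¹ with hx
  have h2' : ∀ z : S, x * (e * (f * (x * z))) = x * z := fun z => by
    rw [← mul_assoc e, ← mul_assoc x, ← mul_assoc, h2]
  simp only [mul_assoc] at h1
  -- Both `x` and `f * x * e` are inverses of `e * f`. The latter is visibly idempotent, so `x` is,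
  -- and an idempotent is its own inverse.
  have h3 : f * x * e = x := InverseMonoid.inv_unique (e * f) _
    (by simp only [mul_assoc, he', hf', h1])
    (by simp only [mul_assoc, he', hf', h2'])
  have h4 : IsIdempotentElem x := by
    have h5 : f * x * e * (f * x * e) = f * x * e := by simp only [mul_assoc, h2']
    rwa [h3] at h5
  have h6 : x = e * f := by
    rw [← idempotent_inv_eq h4, hx, inverse_inv_inv]
  rwa [h6] at h4

theorem idempotent_comm {e f : S} (he : IsIdempotentElem e) (hf : IsIdempotentElem f) :
    e * f = f * e := by
  have he' : ∀ z : S, e * (e * z) = e * z := fun z => by rw [← mul_assoc, he.eq]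
  have hf' : ∀ z : S, f * (f * z) = f * z := fun z => by rw [← mul_assoc, hf.eq]
  have hef := isIdempotentElem_mul he hf
  have hfe := isIdempotentElem_mul hf he
  have h : f * e = (e * f)⁻¹ := InverseMonoid.inv_unique (e * f) _
    (by simpa only [IsIdempotentElem, mul_assoc, he', hf'] using hef)
    (by simpa only [IsIdempotentElem, mul_assoc, he', hf'] using hfe)
  rw [h, idempotent_inv_eq hef]

theorem inverse_mul_inv_rev (a b : S) : (a * b)⁻¹ = b⁻¹ * a⁻¹ := by
  have hc := idempotent_comm (isIdempotentElem_mul_inv b) (isIdempotentElem_inv_mul a)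
  refine (InverseMonoid.inv_unique (a * b) _ ?_ ?_).symm
  · calc a * b * (b⁻¹ * a⁻¹) * (a * b) = a * (b * b⁻¹ * (a⁻¹ * a)) * b := by
          simp only [mul_assoc]
      _ = a * a⁻¹ * a * (b * b⁻¹ * b) := by rw [hc]; simp only [mul_assoc]
      _ = a * b := by rw [InverseMonoid.mul_inv_mul, InverseMonoid.mul_inv_mul]
  · calc b⁻¹ * a⁻¹ * (a * b) * (b⁻¹ * a⁻¹) = b⁻¹ * (a⁻¹ * a * (b * b⁻¹)) * a⁻¹ := by
          simp only [mul_assoc]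
      _ = b⁻¹ * b * b⁻¹ * (a⁻¹ * a * a⁻¹) := by rw [← hc]; simp only [mul_assoc]
      _ = b⁻¹ * a⁻¹ := by rw [InverseMonoid.inv_mul_inv, InverseMonoid.inv_mul_inv]

theorem isIdempotentElem_conj (s : S) {e : S} (he : IsIdempotentElem e) :
    IsIdempotentElem (s⁻¹ * e * s) := by
  have hc := idempotent_comm he (isIdempotentElem_mul_inv s)
  calc s⁻¹ * e * s * (s⁻¹ * e * s) = s⁻¹ * (e * (s * s⁻¹)) * (e * s) := by
        simp only [mul_assoc]
    _ = s⁻¹ * s * s⁻¹ * (e * e) * s := by rw [hc]; simp only [mul_assoc]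
    _ = s⁻¹ * e * s := by rw [InverseMonoid.inv_mul_inv, he.eq]

/-- Deleting an idempotent factor goes up in the natural order. -/
theorem natLE_mul_idempotent_mul (x y : S) {f : S} (hf : IsIdempotentElem f) :
    NatLE (x * f * y) (x * y) := by
  -- This is `f` carried to the left across `x`.
  refine ⟨x * f * x⁻¹, ?_, ?_⟩
  · simpa only [inverse_inv_inv] using isIdempotentElem_conj x⁻¹ hf
  · have hc := idempotent_comm hf (isIdempotentElem_inv_mul x)
    calc x * f * y = x * x⁻¹ * x * f * y := by rw [InverseMonoid.mul_inv_mul]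
      _ = x * (x⁻¹ * x * f) * y := by simp only [mul_assoc]
      _ = x * f * x⁻¹ * (x * y) := by rw [← hc]; simp only [mul_assoc]

theorem NatLE.refl (s : S) : NatLE s s := ⟨1, IsIdempotentElem.one, (one_mul s).symm⟩

theorem NatLE.trans {a b c : S} (hab : NatLE a b) (hbc : NatLE b c) : NatLE a c := by
  obtain ⟨e, he, rfl⟩ := hab
  obtain ⟨f, hf, rfl⟩ := hbc
  exact ⟨e * f, isIdempotentElem_mul he hf, (mul_assoc e f c).symm⟩

theorem NatLE.mul {a b s t : S} (h₁ : NatLE a s) (h₂ : NatLE b t) : NatLE (a * b) (s * t) := by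
  obtain ⟨e, he, rfl⟩ := h₁
  obtain ⟨f, hf, rfl⟩ := h₂
  refine NatLE.trans ⟨e, he, ?_⟩ (natLE_mul_idempotent_mul s t hf)
  simp only [mul_assoc]

theorem NatLE.inv {a s : S} (h : NatLE a s) : NatLE a⁻¹ s⁻¹ := by
  obtain ⟨e, he, rfl⟩ := h
  simpa only [inverse_mul_inv_rev, idempotent_inv_eq he, mul_one] using
    natLE_mul_idempotent_mul s⁻¹ 1 he

/-! ### Closures and normal inverse subsemigroups -/

theorem subset_natClosure (A : Set S) : A ⊆ natClosure A :=
  fun _ ha _ hC => hC.2 ha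

theorem isNatClosed_natClosure (A : Set S) : IsNatClosed (natClosure A) :=
  fun a ha s h C hC => hC.1 a (ha C hC) s h

theorem mem_natClosure {A : Set S} {s : S} : s ∈ natClosure A ↔ ∃ a ∈ A, NatLE a s := by
  constructor
  · intro hs
    refine hs {s | ∃ a ∈ A, NatLE a s} ⟨?_, fun a ha => ⟨a, ha, NatLE.refl a⟩⟩
    rintro a ⟨b, hb, hba⟩ t hat
    exact ⟨b, hb, hba.trans hat⟩
  · rintro ⟨a, ha, h⟩
    exact isNatClosed_natClosure A a (subset_natClosure A ha) s h

theorem isNormal_natClosure {N : Set S} (hN : IsNormalInverseSubsemigroup N) :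
    IsNormalInverseSubsemigroup (natClosure N) where
  mul_mem a ha b hb := by
    obtain ⟨m, hm, hma⟩ := mem_natClosure.1 ha
    obtain ⟨n, hn, hnb⟩ := mem_natClosure.1 hb
    exact mem_natClosure.2 ⟨m * n, hN.mul_mem m hm n hn, hma.mul hnb⟩
  inv_mem a ha := by
    obtain ⟨m, hm, hma⟩ := mem_natClosure.1 ha
    exact mem_natClosure.2 ⟨m⁻¹, hN.inv_mem m hm, hma.inv⟩
  full e he := subset_natClosure N (hN.full e he)
  conj_mem s a ha := by
    obtain ⟨m, hm, hma⟩ := mem_natClosure.1 ha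
    exact mem_natClosure.2
      ⟨s⁻¹ * m * s, hN.conj_mem s m hm, ((NatLE.refl _).mul hma).mul (NatLE.refl _)⟩

theorem subset_normalGenerated (Q : Set S) : Q ⊆ normalGenerated Q :=
  fun _ hq _ hN => hN.2 hq

theorem isNormal_normalGenerated (Q : Set S) :
    IsNormalInverseSubsemigroup (normalGenerated Q) where
  mul_mem a ha b hb N hN := hN.1.mul_mem a (ha N hN) b (hb N hN)
  inv_mem a ha _ hN := hN.1.inv_mem a (ha _ hN)
  full e he _ hN := hN.1.full e he
  conj_mem s n hn N hN := hN.1.conj_mem s n (hn N hN)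

/-- The group congruence determined by a closed normal inverse subsemigroup. -/
def closedNormalCon (C : Set S) (hC : IsNormalInverseSubsemigroup C) (hcl : IsNatClosed C) :
    Con S where
  r a b := a⁻¹ * b ∈ C
  iseqv :=
    { refl := fun a => hC.full _ (isIdempotentElem_inv_mul a)
      symm := fun {a b} h => by
        simpa only [inverse_mul_inv_rev, inverse_inv_inv] using hC.inv_mem _ h
      trans := fun {a b c} h₁ h₂ => by
        -- The product is a⁻¹(bb⁻¹)c; closedness allows bb⁻¹ to be deleted.
        refine hcl _ (hC.mul_mem _ h₁ _ h₂) _ ?_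
        simpa only [mul_assoc] using
          natLE_mul_idempotent_mul a⁻¹ c (isIdempotentElem_mul_inv b) }
  mul' {a b c d} h₁ h₂ := by
    -- Deleting cc⁻¹ from c⁻¹(a⁻¹b)c · c⁻¹d leaves (ac)⁻¹(bd).
    refine hcl _ (hC.mul_mem _ (hC.conj_mem c _ h₁) _ h₂) _ ?_
    simpa only [inverse_mul_inv_rev, mul_assoc] using
      natLE_mul_idempotent_mul (c⁻¹ * (a⁻¹ * b)) d (isIdempotentElem_mul_inv c)

/-- If `s` is related to an idempotent `e`, then `e * s` is in `C` and lies below `s`. -/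
theorem conKernel_subset_of_le {ρ : Con S} {C : Set S} (hC : IsNormalInverseSubsemigroup C)
    (hcl : IsNatClosed C) (hρ : ρ ≤ closedNormalCon C hC hcl) : conKernel ρ ⊆ C := by
  rintro s ⟨e, he, hse⟩
  have h : e⁻¹ * s ∈ C := hρ (ρ.symm hse)
  rw [idempotent_inv_eq he] at h
  exact hcl _ h s ⟨e, he, rfl⟩

/-! ### Kernels of homomorphisms -/

section Hom

variable {M : Type*} [InverseMonoid M]

theorem inverse_map_inv (π : S →* M) (a : S) : π a⁻¹ = (π a)⁻¹ :=
  InverseMonoid.inv_unique _ _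
    (by rw [← map_mul, ← map_mul, InverseMonoid.mul_inv_mul])
    (by rw [← map_mul, ← map_mul, InverseMonoid.inv_mul_inv])

theorem mem_conKernel_ker (π : S →* M) {s : S} :
    s ∈ conKernel (Con.ker π) ↔ IsIdempotentElem (π s) := by
  constructor
  · rintro ⟨e, he, h⟩
    rw [(Con.ker_rel π).1 h]
    exact he.map π
  · intro h
    refine ⟨s * s⁻¹, isIdempotentElem_mul_inv s, (Con.ker_rel π).2 ?_⟩
    rw [map_mul, inverse_map_inv, idempotent_inv_eq h, h.eq]

theorem isNormal_conKernel_ker (π : S →* M) :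
    IsNormalInverseSubsemigroup (conKernel (Con.ker π)) where
  mul_mem a ha b hb := by
    rw [mem_conKernel_ker] at *
    rw [map_mul]
    exact isIdempotentElem_mul ha hb
  inv_mem a ha := by
    rw [mem_conKernel_ker] at *
    rwa [inverse_map_inv, idempotent_inv_eq ha]
  full e he := (mem_conKernel_ker π).2 (he.map π)
  conj_mem s n hn := by
    rw [mem_conKernel_ker] at *
    rw [map_mul, map_mul, inverse_map_inv]
    exact isIdempotentElem_conj _ hn

theorem isEUnitary_iff_isNatClosed_conKernel {π : S →* M} (hπ : Function.Surjective π) :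
    IsEUnitary M ↔ IsNatClosed (conKernel (Con.ker π)) := by
  constructor
  · rintro hM _ ha s ⟨e, he, rfl⟩
    rw [mem_conKernel_ker] at *
    exact hM _ _ ha ⟨π e, he.map π, map_mul π e s⟩
  · rintro hK _ s hfs ⟨f, hf, rfl⟩
    obtain ⟨t, rfl⟩ := hπ s
    obtain ⟨u, rfl⟩ := hπ f
    -- The preimage `u` of `f` need not be idempotent, but `u * u⁻¹` is, and it also maps to `f`.
    refine (mem_conKernel_ker π).1
      (hK (u * u⁻¹ * t) ?_ t ⟨_, isIdempotentElem_mul_inv u, rfl⟩)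
    rw [mem_conKernel_ker, map_mul, map_mul, inverse_map_inv, idempotent_inv_eq hf, hf.eq]
    exact hfs

end Hom

end General

section Free

variable {X : Type*}

theorem presKernel_subset_natClosure_presNormal (R : Set (FIM X × FIM X)) :
    presKernel R ⊆ natClosure (presNormal R) :=
  conKernel_subset_of_le (isNormal_natClosure (isNormal_normalGenerated _))
    (isNatClosed_natClosure _) <| Con.conGen_le.2 fun l r h =>
      subset_natClosure _ (subset_normalGenerated _ ⟨l, r, h, Or.inl rfl⟩)

theorem presNormal_subset_conKernel_ker {M : Type*} [InverseMonoid M]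
    {R : Set (FIM X × FIM X)} {π : FIM X →* M} (hR : ∀ l r, (l, r) ∈ R → π l = π r) :
    presNormal R ⊆ conKernel (Con.ker π) := by
  refine fun s hs => hs _ ⟨isNormal_conKernel_ker π, ?_⟩
  rintro _ ⟨l, r, h, rfl | rfl⟩ <;> rw [mem_conKernel_ker, map_mul, inverse_map_inv, hR l r h]
  · exact isIdempotentElem_inv_mul _
  · exact isIdempotentElem_mul_inv _

end Free

end InvMon

theorem mainTheorem8 {X : Type*} (R : Set (InvMon.FIM X × InvMon.FIM X))
    {M : Type*} [InvMon.InverseMonoid M] (iso : (InvMon.presCon R).Quotient ≃* M) :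
    (InvMon.IsEUnitary M ↔
      (InvMon.IsInverseSubmonoid (InvMon.presKernel R) ∧
        InvMon.IsNatClosed (InvMon.presKernel R))) ∧
    (InvMon.IsEUnitary M →
      InvMon.presKernel R = InvMon.natClosure (InvMon.presNormal R)) := by
  let π : InvMon.FIM X →* M := iso.toMonoidHom.comp (InvMon.presCon R).mk'
  have hker : InvMon.presCon R = Con.ker π := Con.ext fun a b =>
    (Con.eq _).symm.trans iso.injective.eq_iff.symm
  have hK : InvMon.presKernel R = InvMon.conKernel (Con.ker π) :=
    congrArg InvMon.conKernel hker
  have hN := InvMon.isNormal_conKernel_ker π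
  have hiff : InvMon.IsEUnitary M ↔ InvMon.IsNatClosed (InvMon.presKernel R) :=
    hK ▸ InvMon.isEUnitary_iff_isNatClosed_conKernel
      (iso.surjective.comp Con.mk'_surjective)
  have hsub : InvMon.IsInverseSubmonoid (InvMon.presKernel R) :=
    hK ▸ ⟨hN.toIsInverseSubsemigroup, hN.full 1 IsIdempotentElem.one⟩
  refine ⟨hiff.trans (and_iff_right hsub).symm, fun hM => ?_⟩
  refine (InvMon.presKernel_subset_natClosure_presNormal R).antisymm fun s hs => ?_
  refine hs _ ⟨hiff.1 hM, hK ▸ InvMon.presNormal_subset_conKernel_ker fun l r h => ?_⟩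
  exact congrArg iso ((Con.eq _).2 (ConGen.Rel.of l r h))
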